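/- Let $\mathbb{E}_1,\mathbb{E}_2$ be finite-dimensional real inner product spaces and let $K\subset\mathbb{E}_2$ be a closed convex cone (so $\lambda x\in K$ for all $\lambda\ge 0$, $x\in K$), with polar cone $K^\circ=\{v\in\mathbb{E}_2:\langle v,x\rangle\le 0\ \ \forall x\in K\}$. Let $F:\mathbb{E}_1\to\mathbb{E}_2\cup\{+\infty_\bullet\}$, where $+\infty_\bullet\notin\mathbb{E}_2$ is an added largest element, have nonempty domain $\mathrm{dom}\,F=\{x: F(x)\in\mathbb{E}_2\}$, and let $F$ be $K$-convex, i.e. its $K$-epigraph $K\text{-}\mathrm{epi}\,F=\{(x,y)\in\mathbb{E}_1\times\mathbb{E}_2:\ x\in\mathrm{dom}\,F,\ y-F(x)\in K\}$ is convex. Let $f:\mathbb{E}_1\to\mathbb{R}\cup\{+\infty\}$ and $g:\mathbb{E}_2\to\mathbb{R}\cup\{+\infty\}$ be proper convex functions (not necessarily lower semicontinuous), and assume that $$g(F(x))\le g(y)\qquad\text{for all }(x,y)\in K\text{-}\mathrm{epi}\,F.$$ Put $(g\circ F)(x)=g(F(x))$ and, for $v\in\mathbb{E}_2$, $\langle v,F\rangle(x)=\langle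 v,F(x)\rangle$ if $x\in\mathrm{dom}\,F$, and let both be $+\infty$ if $x\notin\mathrm{dom}\,F$. For an extended-real-valued function $h$ write $\mathrm{dom}\,h=\{x:h(x)<+\infty\}$, $h^*(p)=\sup_x\{\langle p,x\rangle-h(x)\}$ for its Fenchel conjugate and $\partial h(\bar x)=\{v: h(\bar x)+\langle v,x-\bar x\rangle\le h(x)\ \ \forall x\}$ for its subdifferential at $\bar x\in\mathrm{dom}\,h$; $\mathrm{ri}$ denotes the relative interior. Consider the qualification condition $$F\big(\mathrm{ri}(\mathrm{dom}\,f)\cap\mathrm{ri}(\mathrm{dom}\,F)\big)\cap\mathrm{ri}(\mathrm{dom}\,g-K)\neq\emptyset.\tag{CQ}$$ Then the following hold. a) If (CQ) holds, then for every $p\in\mathbb{E}_1$ $$(f+g\circ F)^*(p)=\min_{v\in -K^\circ,\ y\in\mathbb{E}_1}\ g^*(v)+f^*(y)+\langle v,F\rangle^*(p-y),$$ where the minimum is attained (its value may be $+\infty$). b) For every $\bar x\in\mathrm{dom}\,f\cap\mathrm{dom}(g\circ F)$, $$\partial(f+g\circ F)(\bar x)\supset\partial f(\bar x)+\bigcup_{v\in\partial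 g(F(\bar x))}\partial\langle v,F\rangle(\bar x),$$ and equality holds if (CQ) is satisfied. -/

import Mathlib

open scoped Pointwise

namespace ConvexComposite

noncomputable section

/-! Extended-real-valued functions `f : E → ℝ ∪ {+∞}` are modelled by `f : E → EReal`; not taking
the value `-∞` is part of `IsProper`.  Functions with values in `E₂ ∪ {+∞}`, where `+∞` is an
additional largest element, are modelled by `F : E₁ → WithTop E₂`. -/

/-- The (effective) domain `{x | f x < +∞}` of an extended-real-valued function. -/
def effDom {E : Type*} (f : E → EReal) : Set E := {x | f x < ⊤}

/-- `f` is proper: its domain is nonempty and it never takes the value `-∞`. -/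
def IsProper {E : Type*} (f : E → EReal) : Prop := (effDom f).Nonempty ∧ ∀ x, f x ≠ ⊥

/-- The epigraph `{(x, α) ∈ E × ℝ | f x ≤ α}`. -/
def epigraph {E : Type*} (f : E → EReal) : Set (E × ℝ) := {q | f q.1 ≤ (q.2 : EReal)}

/-- `f` belongs to the class of proper convex functions; convexity is convexity of the
epigraph. -/
def IsProperConvex {E : Type*} [AddCommGroup E] [Module ℝ E] (f : E → EReal) : Prop :=
  IsProper f ∧ Convex ℝ (epigraph f)

/-- The Fenchel conjugate `f*(y) = sup_x (⟨y, x⟩ - f x)`. -/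
def conjugate {E : Type*} [NormedAddCommGroup E] [InnerProductSpace ℝ E] (f : E → EReal)
    (y : E) : EReal :=
  ⨆ x : E, ((inner ℝ y x : ℝ) : EReal) - f x

/-- The subdifferential `{v | f x₀ + ⟨v, x - x₀⟩ ≤ f x for all x}` of `f` at `x₀`, which is meant
for `x₀` in the domain of `f`. -/
def subdifferential {E : Type*} [NormedAddCommGroup E] [InnerProductSpace ℝ E] (f : E → EReal)
    (x₀ : E) : Set E :=
  {v | ∀ x : E, f x₀ + ((inner ℝ v (x - x₀) : ℝ) : EReal) ≤ f x}

/-- `K` is a cone: `c • x ∈ K` for all `c ≥ 0` and `x ∈ K`. -/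
def IsCone {E : Type*} [AddCommGroup E] [Module ℝ E] (K : Set E) : Prop :=
  ∀ c : ℝ, 0 ≤ c → ∀ x ∈ K, c • x ∈ K

/-- The polar cone `{v | ⟨v, x⟩ ≤ 0 for all x ∈ K}`. -/
def polarCone {E : Type*} [NormedAddCommGroup E] [InnerProductSpace ℝ E] (K : Set E) : Set E :=
  {v | ∀ x ∈ K, (inner ℝ v x : ℝ) ≤ 0}

/-- The domain `{x | F x ∈ E₂}` of `F : E₁ → E₂ ∪ {+∞}`. -/
def vectorDom {E₁ E₂ : Type*} (F : E₁ → WithTop E₂) : Set E₁ := {x | F x ≠ ⊤}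

/-- The `K`-epigraph `{(x, v) ∈ E₁ × E₂ | F x ≤_K v}`, where `z ≤_K v` means `v - z ∈ K` for
`z ∈ E₂`, while the largest element `+∞` is not `≤_K v` for any `v ∈ E₂`. -/
def coneEpigraph {E₁ E₂ : Type*} [AddCommGroup E₂] (K : Set E₂) (F : E₁ → WithTop E₂) :
    Set (E₁ × E₂) :=
  {q | ∃ z : E₂, F q.1 = (z : WithTop E₂) ∧ q.2 - z ∈ K}

/-- `F` is `K`-convex: its `K`-epigraph is a convex subset of `E₁ × E₂`. -/
def IsConeConvex {E₁ E₂ : Type*} [AddCommGroup E₁] [Module ℝ E₁] [AddCommGroup E₂] [Module ℝ E₂]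
    (K : Set E₂) (F : E₁ → WithTop E₂) : Prop :=
  Convex ℝ (coneEpigraph K F)

/-- The composition `g ∘ F`, with value `g (F x)` for `x ∈ dom F` and `+∞` otherwise. -/
def compTop {E₁ E₂ : Type*} (g : E₂ → EReal) (F : E₁ → WithTop E₂) (x : E₁) : EReal :=
  WithTop.recTopCoe (C := fun _ => EReal) ⊤ g (F x)

theorem compTop_of_eq_coe {E₁ E₂ : Type*} (g : E₂ → EReal) (F : E₁ → WithTop E₂) {x : E₁} {z : E₂}
    (h : F x = (z : WithTop E₂)) : compTop g F x = g z := by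
  simp [compTop, h]

theorem compTop_of_eq_top {E₁ E₂ : Type*} (g : E₂ → EReal) (F : E₁ → WithTop E₂) {x : E₁}
    (h : F x = ⊤) : compTop g F x = ⊤ := by
  simp [compTop, h]

/-- The scalarization `⟨v, F⟩`, with value `⟨v, F x⟩` for `x ∈ dom F` and `+∞` otherwise. -/
def scalarize {E₁ E₂ : Type*} [NormedAddCommGroup E₂] [InnerProductSpace ℝ E₂] (v : E₂)
    (F : E₁ → WithTop E₂) : E₁ → EReal :=
  compTop (fun z => ((inner ℝ v z : ℝ) : EReal)) F

/-- The qualification condition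
`F (ri (dom f) ∩ ri (dom F)) ∩ ri (dom g - K) ≠ ∅`; the second set is embedded into
`E₂ ∪ {+∞}`. -/
def Qualification {E₁ E₂ : Type*} [NormedAddCommGroup E₁] [InnerProductSpace ℝ E₁]
    [NormedAddCommGroup E₂] [InnerProductSpace ℝ E₂] (K : Set E₂) (f : E₁ → EReal)
    (g : E₂ → EReal) (F : E₁ → WithTop E₂) : Prop :=
  (F '' (intrinsicInterior ℝ (effDom f) ∩ intrinsicInterior ℝ (vectorDom F)) ∩
    (fun z : E₂ => (z : WithTop E₂)) '' intrinsicInterior ℝ (effDom g - K)).Nonempty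

end

end ConvexComposite

open ConvexComposite

/-! Weak duality is the sum of three Fenchel–Young inequalities at one point `x`, where the terms
`⟨v, F x⟩` cancel. For the converse, let the conjugate at `p` be at most `α` and perturb: collect
the points `(a - x, b - y, f a + g b - ⟨p, x⟩ + α)` with `(x, y)` in the `K`-epigraph. Monotonicity
of `g` makes the height nonnegative over the origin, and (CQ) puts the origin in the relative
interior of the projection (`Qualification.exists_neg_smul_mem`). A linear minorant `(s, t)` then
exists (`exists_linear_minorant`); its inequality separates the variables, and three suprema give
the bound with `v = t`, `y = s`. Part b) is the equality case. -/

open Filter Topology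

namespace ConvexComposite

/-! ### Separation by the M. Riesz extension theorem -/

section Separation

variable {E : Type*} [AddCommGroup E] [Module ℝ E]

/-- A convex set in `E × ℝ` whose projection to `E` contains with every point a negative multiple
of it, and which lies above `0` over the origin, lies above the graph of a linear functional. -/
theorem exists_linear_minorant {S : Set (E × ℝ)} (hS : Convex ℝ S) (hne : S.Nonempty)
    (hcore : ∀ q ∈ S, ∃ ε : ℝ, 0 < ε ∧ ∃ r : ℝ, (-(ε • q.1), r) ∈ S)
    (hnonneg : ∀ r : ℝ, ((0 : E), r) ∈ S → 0 ≤ r) :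
    ∃ l : E →ₗ[ℝ] ℝ, ∀ q ∈ S, l q.1 ≤ q.2 := by
  let C : PointedCone ℝ (E × ℝ) := PointedCone.ofConeComb
    {v | ∃ c : ℝ, 0 ≤ c ∧ ∃ q ∈ S, c • q = v}
    (by obtain ⟨q, hq⟩ := hne; exact ⟨q, 1, zero_le_one, q, hq, one_smul _ _⟩)
    (by
      rintro _ ⟨c, hc, q, hq, rfl⟩ _ ⟨d, hd, q', hq', rfl⟩ a ha b hb
      simp only [smul_smul]
      rcases (add_nonneg (mul_nonneg ha hc) (mul_nonneg hb hd)).eq_or_lt with h | h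
      · have h1 : a * c = 0 := by linarith [mul_nonneg ha hc, mul_nonneg hb hd]
        have h2 : b * d = 0 := by linarith [mul_nonneg ha hc, mul_nonneg hb hd]
        exact ⟨0, le_rfl, q, hq, by simp [h1, h2]⟩
      · refine ⟨_, h.le, _, convex_iff_div.1 hS hq hq' (mul_nonneg ha hc) (mul_nonneg hb hd) h, ?_⟩
        simp only [smul_add, smul_smul, mul_div_cancel₀ _ h.ne'])
  have hC : ∀ v, v ∈ C ↔ ∃ c : ℝ, 0 ≤ c ∧ ∃ q ∈ S, c • q = v := fun v => Iff.rfl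
  have hSC : ∀ q ∈ S, q ∈ C := fun q hq =>
    (hC q).2 ⟨1, zero_le_one, q, hq, one_smul _ _⟩
  have hneg : ∀ d r, (d, r) ∈ C → ∃ r', (-d, r') ∈ C := by
    intro d r h
    obtain ⟨c, hc, q, hq, hcq⟩ := (hC _).1 h
    obtain ⟨ε, hε, r', hr'⟩ := hcore q hq
    refine ⟨(c / ε) * r', (hC _).2 ⟨c / ε, by positivity, _, hr', ?_⟩⟩
    have hd : c • q.1 = d := congrArg Prod.fst hcq
    ext
    · simp [← hd, smul_smul, div_mul_cancel₀ c hε.ne']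
    · simp
  -- The projection of the cone is a subspace because `hneg` supplies opposites.
  let L : Submodule ℝ E :=
    { carrier := {d | ∃ r, (d, r) ∈ C}
      add_mem' := by
        rintro a b ⟨r, hr⟩ ⟨s, hs⟩
        exact ⟨r + s, C.add_mem hr hs⟩
      zero_mem' := ⟨0, C.zero_mem⟩
      smul_mem' := by
        rintro c d ⟨r, hr⟩
        rcases le_total 0 c with hc | hc
        · exact ⟨c * r, C.smul_mem hc hr⟩
        · obtain ⟨r', hr'⟩ := hneg _ _ hr
          refine ⟨(-c) * r', ?_⟩
          have := C.smul_mem (neg_nonneg.2 hc) hr'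
          simpa using this }
  let C' : PointedCone ℝ (L × ℝ) := C.comap (L.subtype.prodMap LinearMap.id)
  have hC' : ∀ (d : L) (r : ℝ), (d, r) ∈ C' ↔ ((d : E), r) ∈ C := fun d r => Iff.rfl
  -- On the vertical axis take `(0, r) ↦ r`. A positive extension `G` satisfies `G (d, r) = G (d, 0)
  -- + r ≥ 0` on the cone, so `-G (·, 0)` is the minorant.
  let φ : (L × ℝ) →ₗ.[ℝ] ℝ :=
    ⟨LinearMap.ker (LinearMap.fst ℝ L ℝ), (LinearMap.snd ℝ L ℝ).domRestrict _⟩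
  obtain ⟨G, hG, hGC⟩ := riesz_extension C' φ
    (by
      rintro ⟨⟨d, r⟩, hd⟩ h
      have hd0 : d = 0 := hd
      subst hd0
      obtain ⟨c, hc, q, hq, hcq⟩ := (hC _).1 ((hC' 0 r).1 h)
      have h1 : c • q.1 = 0 := congrArg Prod.fst hcq
      have h2 : c • q.2 = r := congrArg Prod.snd hcq
      change 0 ≤ r
      rw [← h2]
      rcases smul_eq_zero.1 h1 with rfl | hq1
      · simp
      · exact mul_nonneg hc (hnonneg q.2 (by rw [← hq1]; exact hq)))
    (by
      rintro ⟨⟨d, hd⟩, r⟩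
      obtain ⟨r', hr'⟩ := hd
      refine ⟨⟨(0, r' - r), rfl⟩, ?_⟩
      have : ((⟨d, ⟨r', hr'⟩⟩ : L), r') ∈ C' := hr'
      simpa using this)
  have hG1 : ∀ r : ℝ, G (0, r) = r := fun r => hG ⟨(0, r), rfl⟩
  obtain ⟨l, hl⟩ := LinearMap.exists_extend (-(G.comp (LinearMap.inl ℝ L ℝ)))
  refine ⟨l, fun q hq => ?_⟩
  have hqC : (q.1, q.2) ∈ C := hSC q hq
  let d : L := ⟨q.1, q.2, hqC⟩
  have h1 : 0 ≤ G (d, q.2) := hGC (d, q.2) hqC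
  have h2 : G (d, q.2) = G (d, 0) + q.2 := by
    rw [← hG1 q.2, ← map_add]; simp [hG1]
  have h3 : l q.1 = -G (d, 0) := LinearMap.congr_fun hl d
  linarith

end Separation

/-! ### Prolongation through relative interior points -/

section RelativeInterior

variable {E : Type*} [NormedAddCommGroup E] [NormedSpace ℝ E]

theorem eventually_add_smul_mem_of_mem_intrinsicInterior {C : Set E} {x d : E}
    (hx : x ∈ intrinsicInterior ℝ C) (hd : d ∈ vectorSpan ℝ C) :
    ∀ᶠ τ in 𝓝 (0 : ℝ), x + τ • d ∈ C := by
  obtain ⟨y, hy, rfl⟩ := mem_intrinsicInterior.1 hx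
  have hmem : ∀ τ : ℝ, (y : E) + τ • d ∈ affineSpan ℝ C := by
    intro τ
    rw [add_comm]
    refine AffineSubspace.vadd_mem_of_mem_direction ?_ y.2
    rw [direction_affineSpan]
    exact Submodule.smul_mem _ _ hd
  let γ : ℝ → affineSpan ℝ C := fun τ => ⟨y + τ • d, hmem τ⟩
  have hγ : Continuous γ := by
    refine Continuous.subtype_mk ?_ _
    fun_prop
  have h0 : γ 0 = y := by ext; simp [γ]
  have := hγ.continuousAt.preimage_mem_nhds (x := 0) (by
    rw [h0]; exact mem_interior_iff_mem_nhds.1 hy)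
  exact this

theorem eventually_add_smul_sub_mem_of_mem_intrinsicInterior {C : Set E} {x a : E}
    (hx : x ∈ intrinsicInterior ℝ C) (ha : a ∈ C) :
    ∀ᶠ τ in 𝓝 (0 : ℝ), x + τ • (x - a) ∈ C :=
  eventually_add_smul_mem_of_mem_intrinsicInterior hx
    (vsub_mem_vectorSpan ℝ (intrinsicInterior_subset hx) ha)

end RelativeInterior

/-! ### Conjugates and subgradients -/

section Epigraph

variable {E : Type*}

theorem effDom_eq_fst_image_epigraph (h : E → EReal) : effDom h = Prod.fst '' epigraph h := by
  ext x
  constructor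
  · intro hx
    obtain ⟨r, hr, -⟩ := EReal.lt_iff_exists_real_btwn.1 (show h x < ⊤ from hx)
    exact ⟨(x, r), hr.le, rfl⟩
  · rintro ⟨⟨x, r⟩, hr, rfl⟩
    exact lt_of_le_of_lt hr (EReal.coe_lt_top r)

theorem mem_effDom_iff {h : E → EReal} {x : E} : x ∈ effDom h ↔ ∃ r : ℝ, h x ≤ r := by
  simp [effDom_eq_fst_image_epigraph, epigraph]

variable [NormedAddCommGroup E] [InnerProductSpace ℝ E]

theorem conjugate_le_coe {h : E → EReal} (hbot : ∀ x, h x ≠ ⊥) {v : E} {c : ℝ}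
    (H : ∀ (x : E) (r : ℝ), h x ≤ r → inner ℝ v x - r ≤ c) : conjugate h v ≤ c := by
  refine iSup_le fun x => ?_
  rcases eq_or_ne (h x) ⊤ with hx | hx
  · simp [hx]
  · lift h x to ℝ using ⟨hx, hbot x⟩ with r hr
    exact_mod_cast H x r hr.symm.le

theorem inner_sub_le_conjugate (h : E → EReal) (v x : E) {r : ℝ} (hr : h x ≤ r) :
    ((inner ℝ v x - r : ℝ) : EReal) ≤ conjugate h v := by
  refine le_trans ?_ (le_iSup (fun x : E => ((inner ℝ v x : ℝ) : EReal) - h x) x)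
  rw [EReal.coe_sub]
  exact EReal.sub_le_sub le_rfl hr

theorem conjugate_ne_bot {h : E → EReal} (hdom : (effDom h).Nonempty) (v : E) :
    conjugate h v ≠ ⊥ := by
  obtain ⟨x, hx⟩ := hdom
  obtain ⟨r, hr⟩ := mem_effDom_iff.1 hx
  exact ne_bot_of_le_ne_bot (EReal.coe_ne_bot _) (inner_sub_le_conjugate h v x hr)

/-- If the affine minorants given by the epigraph are bounded then the conjugate is real and
is the least upper bound. -/
theorem exists_conjugate_eq_coe {h : E → EReal} (hp : IsProper h) {v : E} {c : ℝ}
    (H : ∀ (x : E) (r : ℝ), h x ≤ r → inner ℝ v x - r ≤ c) :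
    ∃ A : ℝ, conjugate h v = A ∧
      ∀ c' : ℝ, (∀ (x : E) (r : ℝ), h x ≤ r → inner ℝ v x - r ≤ c') → A ≤ c' := by
  have h1 : conjugate h v ≠ ⊤ :=
    ne_top_of_le_ne_top (EReal.coe_ne_top c) (conjugate_le_coe hp.2 H)
  refine ⟨(conjugate h v).toReal, (EReal.coe_toReal h1 (conjugate_ne_bot hp.1 v)).symm,
    fun c' H' => ?_⟩
  have := conjugate_le_coe hp.2 H'
  rw [← EReal.coe_toReal h1 (conjugate_ne_bot hp.1 v)] at this
  exact_mod_cast this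

/-- The equality case of Fenchel–Young; it reduces part b) to estimates on conjugates. -/
theorem mem_subdifferential_iff_of_eq_coe {h : E → EReal} (hbot : ∀ x, h x ≠ ⊥) {x₀ v : E} {c : ℝ}
    (hc : h x₀ = c) :
    v ∈ subdifferential h x₀ ↔ conjugate h v ≤ ((inner ℝ v x₀ - c : ℝ) : EReal) := by
  constructor
  · intro hv
    refine conjugate_le_coe hbot fun x r hr => ?_
    have h1 := (hv x).trans hr
    rw [hc] at h1
    have h2 : c + inner ℝ v (x - x₀) ≤ r := by exact_mod_cast h1
    rw [inner_sub_right] at h2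
    linarith
  · intro hv x
    rcases eq_or_ne (h x) ⊤ with hx | hx
    · simp [hx]
    · have h1 := inner_sub_le_conjugate h v x (EReal.coe_toReal hx (hbot x)).symm.le
      rw [hc, ← EReal.coe_toReal hx (hbot x)]
      have h2 : inner ℝ v x - (h x).toReal ≤ inner ℝ v x₀ - c := by exact_mod_cast h1.trans hv
      have h3 : c + inner ℝ v (x - x₀) ≤ (h x).toReal := by
        rw [inner_sub_right]; linarith
      exact_mod_cast h3

end Epigraph

/-! ### Composition and weak duality -/

section Composition

variable {E₁ E₂ : Type*}

theorem exists_coe_of_mem_vectorDom {F : E₁ → WithTop E₂} {x : E₁} (hx : x ∈ vectorDom F) :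
    ∃ z : E₂, F x = z :=
  ⟨(F x).untop hx, (WithTop.coe_untop _ hx).symm⟩

theorem compTop_le_coe_iff {g : E₂ → EReal} {F : E₁ → WithTop E₂} {x : E₁} {r : ℝ} :
    compTop g F x ≤ r ↔ ∃ z : E₂, F x = z ∧ g z ≤ r := by
  rcases eq_or_ne (F x) ⊤ with h | h
  · simp [compTop_of_eq_top g F h, h]
  · obtain ⟨z, hz⟩ := exists_coe_of_mem_vectorDom h
    simp [compTop_of_eq_coe g F hz, hz]

theorem compTop_ne_bot {g : E₂ → EReal} (hg : ∀ z, g z ≠ ⊥) (F : E₁ → WithTop E₂) (x : E₁) :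
    compTop g F x ≠ ⊥ := by
  rcases eq_or_ne (F x) ⊤ with h | h
  · simp [compTop_of_eq_top g F h]
  · obtain ⟨z, hz⟩ := exists_coe_of_mem_vectorDom h
    simp [compTop_of_eq_coe g F hz, hg]

theorem exists_coe_add_of_add_le_coe {a b : EReal} (ha : a ≠ ⊥) (hb : b ≠ ⊥) {r : ℝ}
    (h : a + b ≤ r) : ∃ s t : ℝ, a = s ∧ b = t ∧ s + t ≤ r := by
  have ha' : a ≠ ⊤ := by
    rintro rfl
    rw [EReal.top_add_of_ne_bot hb] at h
    exact EReal.coe_ne_top r (top_le_iff.1 h)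
  have hb' : b ≠ ⊤ := by
    rintro rfl
    rw [EReal.add_top_of_ne_bot ha] at h
    exact EReal.coe_ne_top r (top_le_iff.1 h)
  lift a to ℝ using ⟨ha', ha⟩
  lift b to ℝ using ⟨hb', hb⟩
  exact ⟨a, b, rfl, rfl, by exact_mod_cast h⟩

theorem add_ne_bot {a b : EReal} (ha : a ≠ ⊥) (hb : b ≠ ⊥) : a + b ≠ ⊥ := by
  simp [EReal.add_eq_bot_iff, ha, hb]

theorem isProper_scalarize [NormedAddCommGroup E₂] [InnerProductSpace ℝ E₂]
    {F : E₁ → WithTop E₂} (hF : (vectorDom F).Nonempty) (v : E₂) :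
    IsProper (scalarize v F) := by
  refine ⟨?_, compTop_ne_bot (fun _ => EReal.coe_ne_bot _) F⟩
  obtain ⟨x, hx⟩ := hF
  obtain ⟨z, hz⟩ := exists_coe_of_mem_vectorDom hx
  exact ⟨x, mem_effDom_iff.2 ⟨inner ℝ v z, compTop_le_coe_iff.2 ⟨z, hz, le_rfl⟩⟩⟩

variable [NormedAddCommGroup E₁] [InnerProductSpace ℝ E₁]
  [NormedAddCommGroup E₂] [InnerProductSpace ℝ E₂]
  {K : Set E₂} {F : E₁ → WithTop E₂} {f : E₁ → EReal} {g : E₂ → EReal}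

theorem conjugate_add_comp_le (hf : IsProper f) (hg : IsProper g) (hF : (vectorDom F).Nonempty)
    (p y : E₁) (v : E₂) :
    conjugate (f + compTop g F) p ≤
      conjugate g v + conjugate f y + conjugate (scalarize v F) (p - y) := by
  have hg' := conjugate_ne_bot hg.1 v
  have hf' := conjugate_ne_bot hf.1 y
  have hF' := conjugate_ne_bot (isProper_scalarize hF v).1 (p - y)
  rcases eq_or_ne (conjugate g v + conjugate f y + conjugate (scalarize v F) (p - y)) ⊤
    with h | h
  · rw [h]; exact le_top
  obtain ⟨r, hr⟩ : ∃ r : ℝ,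
      conjugate g v + conjugate f y + conjugate (scalarize v F) (p - y) = r :=
    ⟨_, (EReal.coe_toReal h (add_ne_bot (add_ne_bot hg' hf') hF')).symm⟩
  obtain ⟨m, C, hm, hC, hmC⟩ := exists_coe_add_of_add_le_coe (add_ne_bot hg' hf') hF' hr.le
  obtain ⟨B, A, hB, hA, hBA⟩ := exists_coe_add_of_add_le_coe hg' hf' hm.le
  rw [hr]
  refine conjugate_le_coe (fun x => add_ne_bot (hf.2 x) (compTop_ne_bot hg.2 F x))
    fun x s hs => ?_
  obtain ⟨s₁, s₂, h1, h2, h12⟩ :=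
    exists_coe_add_of_add_le_coe (hf.2 x) (compTop_ne_bot hg.2 F x) hs
  obtain ⟨z, hz, hgz⟩ := compTop_le_coe_iff.1 h2.le
  have i1 := inner_sub_le_conjugate f y x h1.le
  have i2 := inner_sub_le_conjugate g v z hgz
  have i3 := inner_sub_le_conjugate (scalarize v F) (p - y) x (r := inner ℝ v z)
    (compTop_le_coe_iff.2 ⟨z, hz, le_rfl⟩)
  rw [hA, EReal.coe_le_coe_iff] at i1
  rw [hB, EReal.coe_le_coe_iff] at i2
  rw [hC, EReal.coe_le_coe_iff, inner_sub_left] at i3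
  linarith

/-! ### Consequences of the qualification condition -/

/-- Every point of the domain of the perturbation function has a negative multiple there. -/
theorem Qualification.exists_neg_smul_mem (hKcone : IsCone K) (hKconvex : Convex ℝ K)
    (hF : IsConeConvex K F) (hq : Qualification K f g F) {a x : E₁} {b y : E₂}
    (ha : a ∈ effDom f) (hb : b ∈ effDom g) (hxy : (x, y) ∈ coneEpigraph K F) :
    ∃ ε : ℝ, 0 < ε ∧ ∃ a' ∈ effDom f, ∃ b' ∈ effDom g, ∃ x' y', (x', y') ∈ coneEpigraph K F ∧
      a' - x' = -(ε • (a - x)) ∧ b' - y' = -(ε • (b - y)) := by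
  obtain ⟨_, ⟨x₀, ⟨hx₀f, hx₀F⟩, rfl⟩, z₀, hz₀, hFz₀⟩ := hq
  have hFz₀ : F x₀ = z₀ := hFz₀.symm
  have hKadd : ∀ k ∈ K, ∀ l ∈ K, k + l ∈ K := by
    intro k hk l hl
    have := hKcone 2 zero_le_two _ (hKconvex hk hl (a := 1 / 2) (b := 1 / 2)
      (by norm_num) (by norm_num) (by norm_num))
    rwa [smul_add, smul_smul, smul_smul, mul_one_div_cancel two_ne_zero, one_smul, one_smul] at this
  obtain ⟨b₀, hb₀, k₀, hk₀, hbk⟩ := Set.mem_sub.1 (intrinsicInterior_subset hz₀)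
  have h0 : (0 : E₂) ∈ K := by simpa using hKcone 0 le_rfl _ hk₀
  -- `dom g - K` is stable under subtracting elements of `K`, so `K` consists of directions of its
  -- span.
  have hKspan : ∀ k ∈ K, k ∈ vectorSpan ℝ (effDom g - K) := by
    intro k hk
    have := vsub_mem_vectorSpan ℝ (Set.sub_mem_sub hb₀ hk₀)
      (Set.sub_mem_sub hb₀ (hKadd _ hk₀ _ hk))
    simpa using this
  have hbspan : b - z₀ ∈ vectorSpan ℝ (effDom g - K) := by
    have := vsub_mem_vectorSpan ℝ (Set.sub_mem_sub hb h0) (intrinsicInterior_subset hz₀)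
    simpa using this
  have hxF : x ∈ vectorDom F := by
    obtain ⟨z, hz, -⟩ := hxy
    simp only at hz
    simp [vectorDom, hz]
  have pos : ∀ᶠ τ in 𝓝[>] (0 : ℝ), 0 < τ := self_mem_nhdsWithin
  -- Prolong the segment from `x` beyond `x₀`, staying in `dom F`; `z₁` is the value of `F` at the
  -- new point.
  obtain ⟨δ, hδ, hδ0⟩ := (((eventually_add_smul_sub_mem_of_mem_intrinsicInterior hx₀F
    hxF).filter_mono nhdsWithin_le_nhds).and pos).exists
  obtain ⟨z₁, hz₁⟩ := exists_coe_of_mem_vectorDom hδ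
  have e₀ : (x₀, z₀) ∈ coneEpigraph K F := ⟨z₀, hFz₀, by simpa using h0⟩
  have e₁ : (x₀ + δ • (x₀ - x), z₁) ∈ coneEpigraph K F := ⟨z₁, hz₁, by simpa using h0⟩
  have hδ1 : (1 + δ) ≠ 0 := by positivity
  -- `x₀` is a convex combination of the new point and `x`, so `K`-convexity compares `z₀` with the
  -- same combination of `z₁` and `y`.
  have hk₁ : (1 + δ)⁻¹ • (z₁ + δ • y) - z₀ ∈ K := by
    obtain ⟨z, hz, hzK⟩ := hF e₁ hxy (a := (1 + δ)⁻¹) (b := (1 + δ)⁻¹ * δ) (by positivity)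
      (by positivity) (by field_simp)
    have hx : (1 + δ)⁻¹ • (x₀ + δ • (x₀ - x)) + ((1 + δ)⁻¹ * δ) • x = x₀ := by
      rw [mul_smul, ← smul_add, inv_smul_eq_iff₀ hδ1]
      module
    have hz' : F x₀ = z := by rw [← hz]; simp only [Prod.smul_mk, Prod.mk_add_mk, hx]
    rw [hFz₀, WithTop.coe_inj] at hz'
    subst hz'
    simpa [smul_add, mul_smul] using hzK
  -- This direction equals `(z₁ + δ • y - (1 + δ) • z₀) - δ • (b - z₀)`. Moving along it from `z₀`
  -- produces the required difference `b' - y'`.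
  have hd : z₁ - z₀ - δ • (b - y) ∈ vectorSpan ℝ (effDom g - K) := by
    have := Submodule.sub_mem _ (Submodule.smul_mem _ (1 + δ) (hKspan _ hk₁))
      (Submodule.smul_mem _ δ hbspan)
    rw [smul_sub, smul_inv_smul₀ hδ1] at this
    convert this using 1
    module
  have ev1 := (eventually_add_smul_mem_of_mem_intrinsicInterior hz₀ hd).filter_mono
    (nhdsWithin_le_nhds (s := Set.Ioi 0))
  have ev2 : ∀ᶠ τ in 𝓝[>] (0 : ℝ), x₀ + (τ * δ) • (x₀ - a) ∈ effDom f := by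
    have ht : Tendsto (fun τ : ℝ => τ * δ) (𝓝 0) (𝓝 0) := by
      simpa using (continuous_mul_const δ).tendsto (0 : ℝ)
    exact (ht.eventually (eventually_add_smul_sub_mem_of_mem_intrinsicInterior hx₀f ha)).filter_mono
      nhdsWithin_le_nhds
  have ev3 : ∀ᶠ τ in 𝓝[>] (0 : ℝ), τ < 1 :=
    (gt_mem_nhds one_pos).filter_mono nhdsWithin_le_nhds
  obtain ⟨τ, ⟨⟨hτ1, hτ2⟩, hτ3⟩, hτ0⟩ := (((ev1.and ev2).and ev3).and pos).exists
  obtain ⟨b', hb', k, hk, hbk'⟩ := Set.mem_sub.1 hτ1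
  obtain ⟨z', hz', hzK'⟩ := hF e₀ e₁ (a := 1 - τ) (b := τ) (by linarith) hτ0.le (by ring)
  simp only [Prod.smul_mk, Prod.mk_add_mk] at hz' hzK'
  refine ⟨τ * δ, by positivity, _, hτ2, b', hb', _, (1 - τ) • z₀ + τ • z₁ + k,
    ⟨z', hz', ?_⟩, ?_, ?_⟩
  · have := hKadd _ hzK' _ hk
    convert this using 1
    module
  · module
  · rw [eq_add_of_sub_eq hbk']
    module

/-- Writing `z₀ = b₀ - k₀` puts `(x₀, b₀)` in the `K`-epigraph, so `g (F x₀) ≤ g b₀ < ⊤`. -/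
theorem Qualification.exists_mem (hKcone : IsCone K)
    (hmono : ∀ q ∈ coneEpigraph K F, compTop g F q.1 ≤ g q.2) (hq : Qualification K f g F) :
    (0 : E₂) ∈ K ∧ (effDom f ∩ effDom (compTop g F)).Nonempty := by
  obtain ⟨_, ⟨x₀, ⟨hx₀f, -⟩, rfl⟩, z₀, hz₀, hFz₀⟩ := hq
  have hFz₀ : F x₀ = z₀ := hFz₀.symm
  obtain ⟨b₀, hb₀, k₀, hk₀, hbk⟩ := Set.mem_sub.1 (intrinsicInterior_subset hz₀)
  refine ⟨by simpa using hKcone 0 le_rfl _ hk₀, x₀, intrinsicInterior_subset hx₀f, ?_⟩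
  refine lt_of_le_of_lt (hmono (x₀, b₀) ⟨z₀, hFz₀, ?_⟩) hb₀
  simpa [← hbk] using hk₀

theorem exists_inner_add_inner [FiniteDimensional ℝ E₁] [FiniteDimensional ℝ E₂]
    (l : E₁ × E₂ →ₗ[ℝ] ℝ) : ∃ (s : E₁) (t : E₂), ∀ u w, l (u, w) = inner ℝ s u + inner ℝ t w := by
  refine ⟨(InnerProductSpace.toDual ℝ E₁).symm (l.comp (LinearMap.inl ℝ E₁ E₂)).toContinuousLinearMap,
    (InnerProductSpace.toDual ℝ E₂).symm (l.comp (LinearMap.inr ℝ E₁ E₂)).toContinuousLinearMap,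
    fun u w => ?_⟩
  simp [← map_add]

/-! ### Strong duality -/

/-- Multipliers for the composite problem with finite optimal value. -/
theorem Qualification.exists_multipliers [FiniteDimensional ℝ E₁] [FiniteDimensional ℝ E₂]
    (hKcone : IsCone K) (hKconvex : Convex ℝ K) (hF : IsConeConvex K F)
    (hg : Convex ℝ (epigraph g)) (hf : Convex ℝ (epigraph f))
    (hmono : ∀ q ∈ coneEpigraph K F, compTop g F q.1 ≤ g q.2) (hq : Qualification K f g F)
    {p : E₁} {α : ℝ} (hα : conjugate (f + compTop g F) p ≤ α) :
    ∃ (s : E₁) (t : E₂), ∀ (a : E₁) (ra : ℝ) (b : E₂) (rb : ℝ) (x : E₁) (y : E₂),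
      f a ≤ ra → g b ≤ rb → (x, y) ∈ coneEpigraph K F →
        (inner ℝ s a - ra) + (inner ℝ t b - rb) + (inner ℝ (p - s) x - inner ℝ t y) ≤ α := by
  let S : Set ((E₁ × E₂) × ℝ) := {q | ∃ (a : E₁) (ra : ℝ) (b : E₂) (rb : ℝ) (x : E₁) (y : E₂),
    (a, ra) ∈ epigraph f ∧ (b, rb) ∈ epigraph g ∧ (x, y) ∈ coneEpigraph K F ∧
      q = ((a - x, b - y), ra + rb - inner ℝ p x + α)}
  have hS : Convex ℝ S := by
    rintro _ ⟨a, ra, b, rb, x, y, h1, h2, h3, rfl⟩ _ ⟨a', ra', b', rb', x', y', h1', h2', h3', rfl⟩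
      c d hc hd hcd
    refine ⟨_, _, _, _, _, _, hf h1 h1' hc hd hcd, hg h2 h2' hc hd hcd, hF h3 h3' hc hd hcd, ?_⟩
    refine Prod.ext (Prod.ext ?_ ?_) ?_
    · simp only [Prod.smul_mk, Prod.mk_add_mk]; module
    · simp only [Prod.smul_mk, Prod.mk_add_mk]; module
    · simp only [Prod.smul_mk, Prod.mk_add_mk, smul_eq_mul, inner_add_right, inner_smul_right]
      linear_combination α * hcd
  obtain ⟨h0, x₀, hx₀f, hx₀g⟩ := hq.exists_mem hKcone hmono
  have hne : S.Nonempty := by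
    obtain ⟨ra, hra⟩ := mem_effDom_iff.1 hx₀f
    obtain ⟨rb, hrb⟩ := mem_effDom_iff.1 hx₀g
    obtain ⟨z, hz, hgz⟩ := compTop_le_coe_iff.1 hrb
    exact ⟨_, x₀, ra, z, rb, x₀, z, hra, hgz, ⟨z, hz, by simpa using h0⟩, rfl⟩
  obtain ⟨l, hl⟩ := exists_linear_minorant hS hne
    (by
      rintro _ ⟨a, ra, b, rb, x, y, h1, h2, h3, rfl⟩
      obtain ⟨ε, hε, a', ha', b', hb', x', y', hxy', e1, e2⟩ :=
        hq.exists_neg_smul_mem hKcone hKconvex hF (mem_effDom_iff.2 ⟨ra, h1⟩)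
          (mem_effDom_iff.2 ⟨rb, h2⟩) h3
      obtain ⟨ra', hra'⟩ := mem_effDom_iff.1 ha'
      obtain ⟨rb', hrb'⟩ := mem_effDom_iff.1 hb'
      refine ⟨ε, hε, _, a', ra', b', rb', x', y', hra', hrb', hxy', Prod.ext ?_ rfl⟩
      exact Prod.ext e1.symm e2.symm)
    (by
      -- Over the origin `a = x` and `b = y`, so the height dominates `f a + g (F a) - ⟨p, a⟩ + α`.
      rintro r ⟨a, ra, b, rb, x, y, h1, h2, h3, h⟩
      obtain ⟨h4, rfl⟩ := Prod.mk.inj h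
      obtain ⟨h5, h6⟩ := Prod.mk.inj h4
      obtain rfl := sub_eq_zero.1 h5.symm
      obtain rfl := sub_eq_zero.1 h6.symm
      have h7 : (f + compTop g F) a ≤ ((ra + rb : ℝ) : EReal) := by
        rw [EReal.coe_add]
        exact add_le_add h1 ((hmono _ h3).trans h2)
      have h8 := (inner_sub_le_conjugate (f + compTop g F) p a h7).trans hα
      rw [EReal.coe_le_coe_iff] at h8
      linarith)
  obtain ⟨s, t, hst⟩ := exists_inner_add_inner l
  refine ⟨s, t, fun a ra b rb x y h1 h2 h3 => ?_⟩
  have := hl _ ⟨a, ra, b, rb, x, y, h1, h2, h3, rfl⟩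
  simp only [hst, inner_sub_right] at this
  rw [inner_sub_left]
  linarith

theorem Qualification.exists_conjugate_le [FiniteDimensional ℝ E₁] [FiniteDimensional ℝ E₂]
    (hKcone : IsCone K) (hKconvex : Convex ℝ K)
    (hFproper : (vectorDom F).Nonempty) (hF : IsConeConvex K F)
    (hg : IsProperConvex g) (hf : IsProperConvex f)
    (hmono : ∀ q ∈ coneEpigraph K F, compTop g F q.1 ≤ g q.2) (hq : Qualification K f g F)
    {p : E₁} {α : ℝ} (hα : conjugate (f + compTop g F) p ≤ α) :
    ∃ v ∈ -polarCone K, ∃ y : E₁,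
      conjugate g v + conjugate f y + conjugate (scalarize v F) (p - y) ≤ α := by
  obtain ⟨s, t, H⟩ := hq.exists_multipliers hKcone hKconvex hF hg.2 hf.2 hmono hα
  obtain ⟨h0, x₀, hx₀f, hx₀g⟩ := hq.exists_mem hKcone hmono
  obtain ⟨ra, hra⟩ := mem_effDom_iff.1 hx₀f
  obtain ⟨rb, hrb⟩ := mem_effDom_iff.1 hx₀g
  obtain ⟨z, hz, hgz⟩ := compTop_le_coe_iff.1 hrb
  have e₀ : ∀ {x : E₁} {z : E₂}, F x = z → (x, z) ∈ coneEpigraph K F :=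
    fun h => ⟨_, h, by simpa using h0⟩
  refine ⟨t, ?_, s, ?_⟩
  · rw [Set.mem_neg]
    intro k hk
    rw [inner_neg_left, neg_nonpos]
    by_contra! hneg
    have hbound : ∀ c : ℝ, 0 ≤ c → (inner ℝ s x₀ - ra) + (inner ℝ t z - rb) +
        (inner ℝ (p - s) x₀ - (inner ℝ t z + c * inner ℝ t k)) ≤ α := by
      intro c hc
      have := H x₀ ra z rb x₀ (z + c • k) hra hgz
        ⟨z, hz, by simpa using hKcone c hc k hk⟩
      rwa [inner_add_right, inner_smul_right] at this
    set m := (inner ℝ s x₀ - ra) + (inner ℝ t z - rb) + (inner ℝ (p - s) x₀ - inner ℝ t z)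
    -- `y` can move along `k` without bound. The chosen multiple of `k` makes the left side equal `α
    -- + 1`.
    have hb0 := hbound 0 le_rfl
    have hb1 := hbound ((α - m + 1) / -inner ℝ t k)
      (div_nonneg (by linarith) (by linarith))
    have : (α - m + 1) / -inner ℝ t k * inner ℝ t k = -(α - m + 1) := by
      rw [div_neg, neg_mul, div_mul_cancel₀ _ hneg.ne]
    linarith
  -- Suprema are taken one variable at a time; freezing the others at a feasible point shows each
  -- conjugate is finite.
  · obtain ⟨A, hA, hA'⟩ := exists_conjugate_eq_coe hf.1 (v := s)
      (c := α - (inner ℝ t z - rb) - (inner ℝ (p - s) x₀ - inner ℝ t z)) fun a r hr => by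
        linarith [H a r z rb x₀ z hr hgz (e₀ hz)]
    have HA : ∀ (b : E₂) (rb : ℝ) (x : E₁) (y : E₂), g b ≤ rb → (x, y) ∈ coneEpigraph K F →
        A ≤ α - (inner ℝ t b - rb) - (inner ℝ (p - s) x - inner ℝ t y) :=
      fun b rb x y h1 h2 => hA' _ fun a r hr => by linarith [H a r b rb x y hr h1 h2]
    obtain ⟨B, hB, hB'⟩ := exists_conjugate_eq_coe hg.1 (v := t)
      (c := α - A - (inner ℝ (p - s) x₀ - inner ℝ t z)) fun b r hr => by
        linarith [HA b r x₀ z hr (e₀ hz)]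
    have HB : ∀ (x : E₁) (y : E₂), (x, y) ∈ coneEpigraph K F →
        B ≤ α - A - (inner ℝ (p - s) x - inner ℝ t y) :=
      fun x y h => hB' _ fun b r hr => by linarith [HA b r x y hr h]
    have hC : conjugate (scalarize t F) (p - s) ≤ ((α - A - B : ℝ) : EReal) := by
      refine conjugate_le_coe (isProper_scalarize hFproper t).2 fun x r hr => ?_
      obtain ⟨y, hy, hyr⟩ := compTop_le_coe_iff.1 hr
      rw [EReal.coe_le_coe_iff] at hyr
      linarith [HB x y (e₀ hy)]
    rw [hA, hB]
    refine (add_le_add le_rfl hC).trans ?_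
    rw [← EReal.coe_add, ← EReal.coe_add, EReal.coe_le_coe_iff]
    linarith

/-! ### Subdifferential formula -/

theorem subdifferential_add_comp_superset (hf : IsProper f) (hg : IsProper g)
    (hFproper : (vectorDom F).Nonempty)
    {x₀ : E₁} (hx₀ : x₀ ∈ effDom f ∩ effDom (compTop g F)) {z₀ : E₂} (hz₀ : F x₀ = z₀) :
    subdifferential f x₀ + (⋃ v ∈ subdifferential g z₀, subdifferential (scalarize v F) x₀) ⊆
      subdifferential (f + compTop g F) x₀ := by
  have hgc := compTop_of_eq_coe g F hz₀
  lift f x₀ to ℝ using ⟨hx₀.1.ne, hf.2 x₀⟩ with rf hrf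
  have hgz : g z₀ ≠ ⊤ := by rw [← hgc]; exact hx₀.2.ne
  lift g z₀ to ℝ using ⟨hgz, hg.2 z₀⟩ with rg hrg
  have hsum : (f + compTop g F) x₀ = ((rf + rg : ℝ) : EReal) := by
    rw [Pi.add_apply, ← hrf, hgc, EReal.coe_add]
  rintro _ ⟨y, hy, w, hw, rfl⟩
  simp only [Set.mem_iUnion] at hw
  obtain ⟨v, hv, hw⟩ := hw
  rw [mem_subdifferential_iff_of_eq_coe hf.2 hrf.symm] at hy
  rw [mem_subdifferential_iff_of_eq_coe hg.2 hrg.symm] at hv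
  rw [mem_subdifferential_iff_of_eq_coe (isProper_scalarize hFproper v).2
    (compTop_of_eq_coe _ F hz₀)] at hw
  rw [mem_subdifferential_iff_of_eq_coe (h := f + compTop g F)
    (fun x => add_ne_bot (hf.2 x) (compTop_ne_bot hg.2 F x)) hsum]
  have h1 := conjugate_add_comp_le hf hg hFproper (y + w) y v
  rw [add_sub_cancel_left] at h1
  refine h1.trans ((add_le_add (add_le_add hv hy) hw).trans ?_)
  rw [← EReal.coe_add, ← EReal.coe_add, EReal.coe_le_coe_iff]
  simp only [inner_add_left]
  linarith

/-- For a subgradient `w`, strong duality bounds the sum of three conjugates by the sum of their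
Fenchel–Young lower bounds at `x₀`, so each of the three is an equality. -/
theorem Qualification.subdifferential_add_comp_subset
    [FiniteDimensional ℝ E₁] [FiniteDimensional ℝ E₂]
    (hKcone : IsCone K) (hKconvex : Convex ℝ K)
    (hFproper : (vectorDom F).Nonempty) (hF : IsConeConvex K F)
    (hg : IsProperConvex g) (hf : IsProperConvex f)
    (hmono : ∀ q ∈ coneEpigraph K F, compTop g F q.1 ≤ g q.2) (hq : Qualification K f g F)
    {x₀ : E₁} (hx₀ : x₀ ∈ effDom f ∩ effDom (compTop g F)) {z₀ : E₂} (hz₀ : F x₀ = z₀) :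
    subdifferential (f + compTop g F) x₀ ⊆
      subdifferential f x₀ +
        (⋃ v ∈ subdifferential g z₀, subdifferential (scalarize v F) x₀) := by
  have hgc := compTop_of_eq_coe g F hz₀
  lift f x₀ to ℝ using ⟨hx₀.1.ne, hf.1.2 x₀⟩ with rf hrf
  have hgz : g z₀ ≠ ⊤ := by rw [← hgc]; exact hx₀.2.ne
  lift g z₀ to ℝ using ⟨hgz, hg.1.2 z₀⟩ with rg hrg
  have hsum : (f + compTop g F) x₀ = ((rf + rg : ℝ) : EReal) := by
    rw [Pi.add_apply, ← hrf, hgc, EReal.coe_add]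
  intro w hw
  rw [mem_subdifferential_iff_of_eq_coe (h := f + compTop g F)
    (fun x => add_ne_bot (hf.1.2 x) (compTop_ne_bot hg.1.2 F x)) hsum] at hw
  obtain ⟨v, -, y, hvy⟩ := hq.exists_conjugate_le hKcone hKconvex hFproper hF hg hf hmono hw
  have hgv := conjugate_ne_bot hg.1.1 v
  have hfy := conjugate_ne_bot hf.1.1 y
  have hFv := conjugate_ne_bot (isProper_scalarize hFproper v).1 (w - y)
  have hF₀ : scalarize v F x₀ = ((inner ℝ v z₀ : ℝ) : EReal) := compTop_of_eq_coe _ F hz₀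
  obtain ⟨m, C, hm, hC, hmC⟩ := exists_coe_add_of_add_le_coe (add_ne_bot hgv hfy) hFv hvy
  obtain ⟨B, A, hB, hA, hBA⟩ := exists_coe_add_of_add_le_coe hgv hfy hm.le
  have i1 := inner_sub_le_conjugate f y x₀ hrf.symm.le
  have i2 := inner_sub_le_conjugate g v z₀ hrg.symm.le
  have i3 := inner_sub_le_conjugate (scalarize v F) (w - y) x₀ hF₀.le
  rw [hA, EReal.coe_le_coe_iff] at i1
  rw [hB, EReal.coe_le_coe_iff] at i2
  rw [hC, EReal.coe_le_coe_iff] at i3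
  have hm' : B + A = m := by
    rw [hB, hA, ← EReal.coe_add, EReal.coe_eq_coe_iff] at hm
    exact hm
  have hsplit : inner ℝ (w - y) x₀ = inner ℝ w x₀ - inner ℝ y x₀ := inner_sub_left _ _ _
  refine Set.mem_add.2 ⟨y, ?_, w - y, ?_, add_sub_cancel _ _⟩
  · rw [mem_subdifferential_iff_of_eq_coe hf.1.2 hrf.symm, hA, EReal.coe_le_coe_iff]
    linarith
  · simp only [Set.mem_iUnion]
    refine ⟨v, ?_, ?_⟩
    · rw [mem_subdifferential_iff_of_eq_coe hg.1.2 hrg.symm, hB, EReal.coe_le_coe_iff]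
      linarith
    · rw [mem_subdifferential_iff_of_eq_coe (isProper_scalarize hFproper v).2 hF₀, hC,
        EReal.coe_le_coe_iff]
      linarith

end Composition

end ConvexComposite

theorem mainTheorem3 {E₁ E₂ : Type*}
    [NormedAddCommGroup E₁] [InnerProductSpace ℝ E₁] [FiniteDimensional ℝ E₁]
    [NormedAddCommGroup E₂] [InnerProductSpace ℝ E₂] [FiniteDimensional ℝ E₂]
    (K : Set E₂) (hKcone : IsCone K) (hKclosed : IsClosed K) (hKconvex : Convex ℝ K)
    (F : E₁ → WithTop E₂) (hFproper : (vectorDom F).Nonempty) (hF : IsConeConvex K F)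
    (g : E₂ → EReal) (hg : IsProperConvex g)
    (hmono : ∀ q ∈ coneEpigraph K F, compTop g F q.1 ≤ g q.2)
    (f : E₁ → EReal) (hf : IsProperConvex f) :
    (Qualification K f g F → ∀ p : E₁,
      IsLeast
        ((fun q : E₂ × E₁ =>
            conjugate g q.1 + conjugate f q.2 + conjugate (scalarize q.1 F) (p - q.2)) ''
          ((-polarCone K) ×ˢ Set.univ))
        (conjugate (f + compTop g F) p)) ∧
    (∀ x₀ ∈ effDom f ∩ effDom (compTop g F), ∀ z₀ : E₂, F x₀ = (z₀ : WithTop E₂) →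
      subdifferential f x₀ + (⋃ v ∈ subdifferential g z₀, subdifferential (scalarize v F) x₀) ⊆
          subdifferential (f + compTop g F) x₀ ∧
        (Qualification K f g F →
          subdifferential (f + compTop g F) x₀ =
            subdifferential f x₀ +
              (⋃ v ∈ subdifferential g z₀, subdifferential (scalarize v F) x₀))) := by
  refine ⟨fun hq p => ⟨?_, ?_⟩, fun x₀ hx₀ z₀ hz₀ => ?_⟩
  · rcases eq_or_ne (conjugate (f + compTop g F) p) ⊤ with h | h
    -- When the value is `⊤`, weak duality makes every admissible pair a minimizer.
    · refine ⟨(0, 0), ⟨by simp [polarCone], Set.mem_univ _⟩, ?_⟩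
      have := conjugate_add_comp_le hf.1 hg.1 hFproper p 0 0
      rw [h] at this ⊢
      exact top_le_iff.1 this
    · obtain ⟨-, x₀, hx₀f, hx₀g⟩ := hq.exists_mem hKcone hmono
      have hdom : (effDom (f + compTop g F)).Nonempty :=
        ⟨x₀, EReal.add_lt_top hx₀f.ne hx₀g.ne⟩
      have hα := EReal.coe_toReal h (conjugate_ne_bot hdom p)
      obtain ⟨v, hv, y, hvy⟩ :=
        hq.exists_conjugate_le hKcone hKconvex hFproper hF hg hf hmono hα.symm.le
      rw [hα] at hvy
      exact ⟨(v, y), ⟨hv, Set.mem_univ _⟩,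
        le_antisymm hvy (conjugate_add_comp_le hf.1 hg.1 hFproper p y v)⟩
  · rintro _ ⟨⟨v, y⟩, -, rfl⟩
    exact conjugate_add_comp_le hf.1 hg.1 hFproper p y v
  · have hsup := subdifferential_add_comp_superset hf.1 hg.1 hFproper hx₀ hz₀
    exact ⟨hsup, fun hq => Set.Subset.antisymm
      (hq.subdifferential_add_comp_subset hKcone hKconvex hFproper hF hg hf hmono hx₀ hz₀) hsup⟩
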